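/- Let $\alpha\subseteq\lambda$ be partitions, identified with their diagrams (boxes in matrix coordinates), and let $\lambda/\alpha$ be the skew diagram consisting of the boxes of $\lambda$ that are not in $\alpha$. For a partition $\nu$ let $c(\lambda;\alpha,\nu)$ be the Littlewood–Richardson coefficient, i.e. the number of semistandard tableaux of shape $\lambda/\alpha$ and content $\nu$ whose reverse row word (rows read from right to left, from top to bottom) is a lattice word. The skew character of $\lambda/\alpha$ is $[\lambda/\alpha]=\sum_\nu c(\lambda;\alpha,\nu)[\nu]$, where $[\nu]$ denotes the irreducible character of the symmetric group indexed by $\nu$; it is called multiplicity-free if all coefficients $c(\lambda;\alpha,\nu)$ are $0$ or $1$. Suppose that $\lambda/\alpha$ decomposes into two disconnected skew diagrams $A$ and $B$, i.e. $\lambda/\alpha=A\cup B$ with $A,B\neq\emptyset$ and no box of $A$ lies in the same row or in the same column as a box of $B$. Suppose further that at least one of $A$, $B$ is a proper skew diagram, i.e. it is, up to translation, neither the diagram of a partition nor the diagram of a partition rotated by $180^\circ$. Then $[\lambda/\alpha]$ is not multiplicity-free. -/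

import Mathlib

namespace SkewLR

/-- The skew diagram `lam / mu`: the set of boxes of `lam` that are not boxes of `mu`, in matrix
coordinates `(row, column)` starting at `0`. -/
def skewCells (lam mu : YoungDiagram) : Finset (ℕ × ℕ) := lam.cells \ mu.cells

/-- `ReadUpTo c d`: in the reverse row reading (rows from top to bottom, each row from right to
left) the box `c` is read before `d`, or `c = d`. -/
def ReadUpTo (c d : ℕ × ℕ) : Prop := c.1 < d.1 ∨ (c.1 = d.1 ∧ d.2 ≤ c.2)

instance (c d : ℕ × ℕ) : Decidable (ReadUpTo c d) := by
  unfold ReadUpTo; infer_instance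

/-- Littlewood-Richardson tableaux of shape `lam / mu` and content `nu`. A filling is a function on
all of `ℕ × ℕ`, positive on the boxes of the shape and (as a normalization, so that distinct
functions are distinct tableaux) zero elsewhere. -/
structure LRTableau (lam mu nu : YoungDiagram) where
  /-- the entry in each box -/
  entry : ℕ × ℕ → ℕ
  entry_pos : ∀ c ∈ skewCells lam mu, 0 < entry c
  entry_zero : ∀ c, c ∉ skewCells lam mu → entry c = 0
  /-- rows increase weakly -/
  row_weak : ∀ i j, (i, j) ∈ skewCells lam mu → (i, j + 1) ∈ skewCells lam mu →
    entry (i, j) ≤ entry (i, j + 1)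
  /-- columns increase strictly -/
  col_strict : ∀ i j, (i, j) ∈ skewCells lam mu → (i + 1, j) ∈ skewCells lam mu →
    entry (i, j) < entry (i + 1, j)
  /-- the entry `k + 1` occurs as often as the `k`-th part of `nu` says (parts counted from `0`) -/
  content : ∀ k, ((skewCells lam mu).filter (fun c => entry c = k + 1)).card = nu.rowLen k
  /-- the reverse row word is a lattice word: in each nonempty initial segment, which is the part
  of the word up to some box `d`, there are at least as many `k` as `k + 1`, for all `k ≥ 1` -/
  lattice : ∀ d ∈ skewCells lam mu, ∀ k, 1 ≤ k →
    ((skewCells lam mu).filter (fun c => ReadUpTo c d ∧ entry c = k + 1)).card ≤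
      ((skewCells lam mu).filter (fun c => ReadUpTo c d ∧ entry c = k)).card

/-- There are only finitely many tableaux, so that counting them with `Nat.card` is meaningful. -/
instance (lam mu nu : YoungDiagram) : Finite (LRTableau lam mu nu) := by
  have key : ∀ (T : LRTableau lam mu nu) (c : ℕ × ℕ), T.entry c < nu.colLen 0 + 1 := by
    intro T c
    rcases h : T.entry c with _ | k
    · omega
    · have hc : c ∈ skewCells lam mu := by
        by_contra hc
        have := T.entry_zero c hc
        omega
      have hpos : 0 < nu.rowLen k := by
        rw [← T.content k]
        exact Finset.card_pos.mpr ⟨c, Finset.mem_filter.mpr ⟨hc, h⟩⟩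
      have := YoungDiagram.mem_iff_lt_colLen.mp (YoungDiagram.mem_iff_lt_rowLen.mpr hpos)
      omega
  refine Finite.of_injective
    (fun (T : LRTableau lam mu nu) (c : skewCells lam mu) =>
      (⟨T.entry c, key T c⟩ : Fin (nu.colLen 0 + 1))) ?_
  intro S T h
  have hST : S.entry = T.entry := by
    funext c
    by_cases hc : c ∈ skewCells lam mu
    · exact congrArg Fin.val (congrFun h ⟨c, hc⟩)
    · rw [S.entry_zero c hc, T.entry_zero c hc]
  cases S; cases T; cases hST; rfl

/-- The Littlewood-Richardson coefficient `c(lam; mu, nu)`. -/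
noncomputable def lrCoeff (lam mu nu : YoungDiagram) : ℕ := Nat.card (LRTableau lam mu nu)

/-- The skew character `[lam / mu] = ∑ nu, c(lam; mu, nu) [nu]` (sum over the irreducible
characters `[nu]` of the symmetric group) is multiplicity-free: all coefficients in this
decomposition are `0` or `1`. -/
def SkewCharMultiplicityFree (lam mu : YoungDiagram) : Prop :=
  ∀ nu : YoungDiagram, lrCoeff lam mu nu = 0 ∨ lrCoeff lam mu nu = 1

/-- `D` decomposes into the two (nonempty) disconnected diagrams `A` and `B`: no box of `A` is in
the same row or in the same column as a box of `B`. When `D` is a skew diagram, so are `A` and `B`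
automatically. -/
structure DecomposesInto (D A B : Finset (ℕ × ℕ)) : Prop where
  union_eq : A ∪ B = D
  left_nonempty : A.Nonempty
  right_nonempty : B.Nonempty
  disconnected : ∀ a ∈ A, ∀ b ∈ B, a.1 ≠ b.1 ∧ a.2 ≠ b.2

/-- `D` is, up to translation, the diagram of a partition. -/
def IsPartitionShape (D : Finset (ℕ × ℕ)) : Prop :=
  ∃ (nu : YoungDiagram) (a b : ℕ),
    ∀ i j, (i, j) ∈ D ↔ a ≤ i ∧ b ≤ j ∧ (i - a, j - b) ∈ nu

/-- `D` is, up to translation, the diagram of a partition rotated by 180 degrees; `(a, b)` is the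
position of the rotated corner box. -/
def IsRotatedPartitionShape (D : Finset (ℕ × ℕ)) : Prop :=
  ∃ (nu : YoungDiagram) (a b : ℕ),
    ∀ i j, (i, j) ∈ D ↔ i ≤ a ∧ j ≤ b ∧ (a - i, b - j) ∈ nu

/-- A skew diagram is proper if it is neither a partition nor a rotated partition. -/
def IsProper (D : Finset (ℕ × ℕ)) : Prop :=
  ¬ IsPartitionShape D ∧ ¬ IsRotatedPartitionShape D

end SkewLR

namespace SkewLR

open Finset

/-! Littlewood–Richardson tableaux are produced from fillings that are only column-strict and
satisfy the lattice condition row by row: the entries `k + 1` in the first `n + 1` rows are at most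
as many as the `k` in the first `n` rows. Sorting each row turns such a filling into an LR tableau
of the same content (`IsColumnFilling.exists_lrTableau`). Hence two fillings with equal content but
different contents of some initial block of rows give a coefficient at least 2
(`not_multiplicityFree_of_columnFillings`).

Counting column by column, the canonical filling `0, 1, 2, …` down each column meets the lattice
condition in every single column, so all but three columns can be left canonical. The three are the
rightmost and leftmost columns of the proper part and any column of the other part. Properness makes
the leftmost column both start and end strictly lower than the rightmost one
(`exists_columns_of_isProper`), and disconnectedness puts the third column above, between or below
them. In each position two suitable fillings are written down: `hasTwoTripleFillings_of_last` and
`hasTwoTripleFillings_of_first`. -/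

/-! ### Counting boxes by rows and by columns. -/

theorem mem_skewCells_row {lam mu : YoungDiagram} {i j : ℕ} :
    (i, j) ∈ skewCells lam mu ↔ mu.rowLen i ≤ j ∧ j < lam.rowLen i := by
  simp only [skewCells, mem_sdiff, YoungDiagram.mem_cells, YoungDiagram.mem_iff_lt_rowLen, not_lt]
  exact and_comm

theorem mem_skewCells_col {lam mu : YoungDiagram} {i j : ℕ} :
    (i, j) ∈ skewCells lam mu ↔ mu.colLen j ≤ i ∧ i < lam.colLen j := by
  simp only [skewCells, mem_sdiff, YoungDiagram.mem_cells, YoungDiagram.mem_iff_lt_colLen, not_lt]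
  exact and_comm

theorem card_filter_skewCells_rows (lam mu : YoungDiagram) (p : ℕ → ℕ → Prop)
    [∀ i, DecidablePred (p i)] (n : ℕ) :
    #{c ∈ skewCells lam mu | c.1 < n ∧ p c.1 c.2} =
      ∑ i ∈ range n, #{j ∈ Ico (mu.rowLen i) (lam.rowLen i) | p i j} := by
  rw [card_eq_sum_card_fiberwise (f := Prod.fst) (t := range n)]
  · refine sum_congr rfl fun i hi => ?_
    rw [mem_range] at hi
    refine card_bij' (fun c _ => c.2) (fun j _ => (i, j)) ?_ ?_ ?_ ?_
    · rintro ⟨i', j⟩ h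
      simp only [mem_filter, mem_skewCells_row, mem_Ico] at h ⊢
      obtain ⟨⟨h1, -, h2⟩, rfl⟩ := h
      exact ⟨h1, h2⟩
    · intro j h
      simp only [mem_filter, mem_skewCells_row, mem_Ico] at h ⊢
      exact ⟨⟨h.1, hi, h.2⟩, trivial⟩
    · rintro ⟨i', j⟩ h
      simp only [mem_filter] at h
      simp [h.2]
    · intro j _
      rfl
  · intro c hc
    simp only [coe_filter, Set.mem_ofPred_eq] at hc
    simpa using hc.2.1

theorem card_filter_skewCells_cols (lam mu : YoungDiagram) (p : ℕ → ℕ → Prop)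
    [∀ i, DecidablePred (p i)] :
    #{c ∈ skewCells lam mu | p c.1 c.2} =
      ∑ j ∈ range (lam.rowLen 0), #{i ∈ Ico (mu.colLen j) (lam.colLen j) | p i j} := by
  rw [card_eq_sum_card_fiberwise (f := Prod.snd) (t := range (lam.rowLen 0))]
  · refine sum_congr rfl fun j _ => ?_
    refine card_bij' (fun c _ => c.1) (fun i _ => (i, j)) ?_ ?_ ?_ ?_
    · rintro ⟨i, j'⟩ h
      simp only [mem_filter, mem_skewCells_col, mem_Ico] at h ⊢
      obtain ⟨⟨h1, h2⟩, rfl⟩ := h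
      exact ⟨h1, h2⟩
    · intro i h
      simp only [mem_filter, mem_skewCells_col, mem_Ico] at h ⊢
      exact ⟨h, trivial⟩
    · rintro ⟨i, j'⟩ h
      simp only [mem_filter] at h
      simp [h.2]
    · intro i _
      rfl
  · rintro ⟨i, j⟩ hc
    simp only [coe_filter, Set.mem_ofPred_eq, mem_skewCells_row] at hc
    have := lam.rowLen_anti 0 i (Nat.zero_le i)
    simp only [coe_range, Set.mem_Iio]
    omega

/-! ### Column fillings and their row-sorted LR tableaux. -/

/-- The number of boxes of row `i` of `lam / mu` in which `f` takes a value below `k`. -/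
def rowCount (lam mu : YoungDiagram) (f : ℕ → ℕ → ℕ) (i k : ℕ) : ℕ :=
  #{j ∈ Ico (mu.rowLen i) (lam.rowLen i) | f i j < k}

theorem rowCount_mono (lam mu : YoungDiagram) (f : ℕ → ℕ → ℕ) (i : ℕ) :
    Monotone (rowCount lam mu f i) := fun _ _ hkl =>
  card_le_card (monotone_filter_right _ fun _ _ h => lt_of_lt_of_le h hkl)

theorem rowCount_le (lam mu : YoungDiagram) (f : ℕ → ℕ → ℕ) (i k : ℕ) :
    rowCount lam mu f i k ≤ lam.rowLen i - mu.rowLen i := by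
  simpa [rowCount] using card_filter_le (Ico (mu.rowLen i) (lam.rowLen i)) (fun j => f i j < k)

theorem rowCount_succ (lam mu : YoungDiagram) (f : ℕ → ℕ → ℕ) (i k : ℕ) :
    rowCount lam mu f i (k + 1) = rowCount lam mu f i k +
      #{j ∈ Ico (mu.rowLen i) (lam.rowLen i) | f i j = k} := by
  unfold rowCount
  rw [← card_union_of_disjoint]
  · congr 1
    ext j
    simp only [mem_filter, mem_union]
    grind
  · rw [disjoint_filter]
    intro j _ h
    omega

theorem exists_rowCount_eq (lam mu : YoungDiagram) (f : ℕ → ℕ → ℕ) (i : ℕ) :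
    ∃ k, rowCount lam mu f i k = lam.rowLen i - mu.rowLen i := by
  refine ⟨(Ico (mu.rowLen i) (lam.rowLen i)).sup (f i) + 1, ?_⟩
  unfold rowCount
  rw [filter_true_of_mem, Nat.card_Ico]
  intro j hj
  exact Nat.lt_succ_of_le (le_sup (f := f i) hj)

/-- A column-strict filling of a skew diagram (with entries counted from `0`) satisfying the lattice
condition for whole rows. -/
structure IsColumnFilling (lam mu : YoungDiagram) (f : ℕ → ℕ → ℕ) : Prop where
  strict : ∀ i j, (i, j) ∈ skewCells lam mu → (i + 1, j) ∈ skewCells lam mu → f i j < f (i + 1) j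
  lattice : ∀ n k, #{c ∈ skewCells lam mu | c.1 < n + 1 ∧ f c.1 c.2 = k + 1} ≤
    #{c ∈ skewCells lam mu | c.1 < n ∧ f c.1 c.2 = k}

/-- This is column-strictness in a form that survives sorting rows. Both sides count columns lying
in `mu` or carrying a small entry, and each column counted in row `i + 1` is also counted in row
`i`. -/
theorem IsColumnFilling.rowCount_succ_le {lam mu : YoungDiagram} {f : ℕ → ℕ → ℕ}
    (hf : IsColumnFilling lam mu f) (i k : ℕ) :
    mu.rowLen (i + 1) + rowCount lam mu f (i + 1) (k + 1) ≤
      mu.rowLen i + rowCount lam mu f i k := by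
  have key : ∀ i k, mu.rowLen i + rowCount lam mu f i k =
      #(range (mu.rowLen i) ∪ {j ∈ Ico (mu.rowLen i) (lam.rowLen i) | f i j < k}) := by
    intro i k
    rw [card_union_of_disjoint, card_range, rowCount]
    rw [disjoint_left]
    intro j hj
    simp only [mem_range, mem_filter, mem_Ico] at hj ⊢
    omega
  rw [key, key]
  refine card_le_card fun j hj => ?_
  have h1 := mu.rowLen_anti i (i + 1) (Nat.le_succ i)
  have h2 := lam.rowLen_anti i (i + 1) (Nat.le_succ i)
  simp only [mem_union, mem_range, mem_filter, mem_Ico] at hj ⊢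
  rcases hj with hj | ⟨⟨hj1, hj2⟩, hj3⟩
  · omega
  · rcases lt_or_ge j (mu.rowLen i) with h | h
    · exact Or.inl h
    · have := hf.strict i j (mem_skewCells_row.2 ⟨h, by omega⟩) (mem_skewCells_row.2 ⟨hj1, hj2⟩)
      exact Or.inr ⟨⟨h, by omega⟩, by omega⟩

/-- Sorting the rows of a filling. -/
theorem exists_sorted (lam mu : YoungDiagram) (f : ℕ → ℕ → ℕ) :
    ∃ e : ℕ × ℕ → ℕ, (∀ c, c ∉ skewCells lam mu → e c = 0) ∧
      ∀ i j, (i, j) ∈ skewCells lam mu → ∀ k,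
        (e (i, j) ≤ k ↔ j < mu.rowLen i + rowCount lam mu f i k) := by
  classical
  have h : ∀ c : ℕ × ℕ, ∃ v, (c ∉ skewCells lam mu → v = 0) ∧ (c ∈ skewCells lam mu → ∀ k,
        (v ≤ k ↔ c.2 < mu.rowLen c.1 + rowCount lam mu f c.1 k)) := by
    rintro ⟨i, j⟩
    by_cases hc : (i, j) ∈ skewCells lam mu
    · have hc' := mem_skewCells_row.1 hc
      have hex : ∃ k, j < mu.rowLen i + rowCount lam mu f i k := by
        obtain ⟨k, hk⟩ := exists_rowCount_eq lam mu f i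
        exact ⟨k, by omega⟩
      refine ⟨Nat.find hex, fun h => absurd hc h, fun _ k => ?_⟩
      rw [Nat.find_le_iff]
      constructor
      · rintro ⟨m, hm, h⟩
        exact lt_of_lt_of_le h (Nat.add_le_add_left (rowCount_mono _ _ _ _ hm) _)
      · exact fun h => ⟨k, le_rfl, h⟩
    · exact ⟨0, fun _ => rfl, fun h => absurd h hc⟩
  choose e he1 he2 using h
  exact ⟨e, he1, fun i j hc k => he2 (i, j) hc k⟩

/-- Sorting permutes a row; the shift by one appears because `f` counts entries from `0` and
tableaux from `1`. -/
theorem card_row_sorted {lam mu : YoungDiagram} {f : ℕ → ℕ → ℕ} {e : ℕ × ℕ → ℕ}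
    (he : ∀ i j, (i, j) ∈ skewCells lam mu → ∀ k,
      (e (i, j) ≤ k ↔ j < mu.rowLen i + rowCount lam mu f i k)) (i k : ℕ) :
    #{j ∈ Ico (mu.rowLen i) (lam.rowLen i) | e (i, j) = k + 1} =
      #{j ∈ Ico (mu.rowLen i) (lam.rowLen i) | f i j = k} := by
  have h1 := rowCount_succ lam mu f i k
  have h2 := rowCount_le lam mu f i (k + 1)
  rw [show #{j ∈ Ico (mu.rowLen i) (lam.rowLen i) | f i j = k} =
    #(Ico (mu.rowLen i + rowCount lam mu f i k) (mu.rowLen i + rowCount lam mu f i (k + 1))) by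
      rw [Nat.card_Ico]; omega]
  congr 1
  ext j
  simp only [mem_filter, mem_Ico]
  constructor
  · rintro ⟨hj, h⟩
    have a1 := he i j (mem_skewCells_row.2 hj) k
    have a2 := he i j (mem_skewCells_row.2 hj) (k + 1)
    omega
  · rintro hj
    have hj' : mu.rowLen i ≤ j ∧ j < lam.rowLen i := by omega
    have a1 := he i j (mem_skewCells_row.2 hj') k
    have a2 := he i j (mem_skewCells_row.2 hj') (k + 1)
    omega

theorem card_sorted {lam mu : YoungDiagram} {f : ℕ → ℕ → ℕ} {e : ℕ × ℕ → ℕ}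
    (he : ∀ i j, (i, j) ∈ skewCells lam mu → ∀ k,
      (e (i, j) ≤ k ↔ j < mu.rowLen i + rowCount lam mu f i k)) (n k : ℕ) :
    #{c ∈ skewCells lam mu | c.1 < n ∧ e c = k + 1} =
      #{c ∈ skewCells lam mu | c.1 < n ∧ f c.1 c.2 = k} := by
  rw [card_filter_skewCells_rows lam mu (fun i j => e (i, j) = k + 1),
    card_filter_skewCells_rows lam mu (fun i j => f i j = k)]
  exact sum_congr rfl fun i _ => card_row_sorted he i k

theorem filter_skewCells_row_lt (lam mu : YoungDiagram) (p : ℕ × ℕ → Prop) [DecidablePred p]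
    {n : ℕ} (hn : lam.colLen 0 ≤ n) :
    {c ∈ skewCells lam mu | c.1 < n ∧ p c} = {c ∈ skewCells lam mu | p c} := by
  refine filter_congr ?_
  rintro ⟨i, j⟩ hc
  have h := (mem_skewCells_col.1 hc).2
  have := lam.colLen_anti 0 j (Nat.zero_le j)
  simp only [and_iff_right_iff_imp]
  intro _
  omega

/-- The description of the entries by `rowCount` is kept in the conclusion so that tableaux from
different fillings can be told apart. -/
theorem IsColumnFilling.exists_lrTableau {lam mu nu : YoungDiagram} {f : ℕ → ℕ → ℕ}
    (hf : IsColumnFilling lam mu f)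
    (hnu : ∀ k, #{c ∈ skewCells lam mu | f c.1 c.2 = k} = nu.rowLen k) :
    ∃ T : LRTableau lam mu nu, ∀ i j, (i, j) ∈ skewCells lam mu → ∀ k,
      (T.entry (i, j) ≤ k ↔ j < mu.rowLen i + rowCount lam mu f i k) := by
  obtain ⟨e, he0, he⟩ := exists_sorted lam mu f
  refine ⟨⟨e, ?_, he0, ?_, ?_, ?_, ?_⟩, he⟩
  · rintro ⟨i, j⟩ hc
    have h := he i j hc 0
    have h0 : rowCount lam mu f i 0 = 0 := by simp [rowCount]
    have := mem_skewCells_row.1 hc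
    omega
  · intro i j h1 h2
    rw [he i j h1]
    have := (he i (j + 1) h2 _).1 le_rfl
    omega
  · intro i j h1 h2
    have hpos : e (i + 1, j) ≠ 0 := by
      intro h0
      have h := (he _ _ h2 0).1 h0.le
      have h0 : rowCount lam mu f (i + 1) 0 = 0 := by simp [rowCount]
      have := mem_skewCells_row.1 h2
      omega
    obtain ⟨v, hv⟩ := Nat.exists_eq_succ_of_ne_zero hpos
    have h := (he _ _ h2 (v + 1)).1 hv.le
    have := (he i j h1 v).2 (lt_of_lt_of_le h (hf.rowCount_succ_le i v))
    omega
  · intro k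
    rw [← hnu, ← filter_skewCells_row_lt lam mu (fun c => e c = k + 1) le_rfl, card_sorted he,
      filter_skewCells_row_lt lam mu (fun c => f c.1 c.2 = k) le_rfl]
  · rintro ⟨i, j⟩ hd k hk
    obtain ⟨v, rfl⟩ : ∃ v, k = v + 1 := ⟨k - 1, by omega⟩
    -- For a reading that stops in row `i`, overcount the larger entry by all of row `i` and
    -- undercount the smaller one by the rows above it; the row version of the lattice condition
    -- still suffices.
    calc _ ≤ #{c ∈ skewCells lam mu | c.1 < i + 1 ∧ e c = v + 1 + 1} := by
          refine card_le_card (monotone_filter_right _ ?_)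
          rintro c - ⟨h1, h2⟩
          refine ⟨?_, h2⟩
          simp only [ReadUpTo] at h1
          omega
      _ ≤ #{c ∈ skewCells lam mu | c.1 < i ∧ e c = v + 1} := by
          rw [card_sorted he, card_sorted he]
          exact hf.lattice i v
      _ ≤ _ := by
          refine card_le_card (monotone_filter_right _ ?_)
          rintro c - ⟨h1, h2⟩
          exact ⟨Or.inl h1, h2⟩

theorem exists_youngDiagram_rowLen {r : ℕ → ℕ} (hr : Antitone r) {N : ℕ} (hN : r N = 0) :
    ∃ nu : YoungDiagram, ∀ k, nu.rowLen k = r k := by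
  let nu : YoungDiagram :=
    ⟨{c ∈ range N ×ˢ range (r 0) | c.2 < r c.1}, by
      rintro ⟨i, j⟩ ⟨i', j'⟩ ⟨hi, hj⟩ h
      simp only [coe_filter, mem_product, mem_range, Set.mem_ofPred_eq] at h hi hj ⊢
      have := hr hi
      omega⟩
  have hmem : ∀ i j, (i, j) ∈ nu ↔ j < r i := by
    intro i j
    rw [← YoungDiagram.mem_cells]
    simp only [nu, mem_filter, mem_product, mem_range, and_iff_right_iff_imp]
    intro h
    have h0 := hr (Nat.zero_le i)
    refine ⟨?_, by omega⟩
    by_contra hi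
    have := hr (not_lt.1 hi)
    omega
  refine ⟨nu, fun k => ?_⟩
  have h : ∀ j, j < nu.rowLen k ↔ j < r k := fun j => by
    rw [← YoungDiagram.mem_iff_lt_rowLen, hmem]
  exact le_antisymm (not_lt.1 fun hlt => lt_irrefl _ ((h _).1 hlt))
    (not_lt.1 fun hlt => lt_irrefl _ ((h _).2 hlt))

theorem IsColumnFilling.exists_content {lam mu : YoungDiagram} {f : ℕ → ℕ → ℕ}
    (hf : IsColumnFilling lam mu f) :
    ∃ nu : YoungDiagram, ∀ k, #{c ∈ skewCells lam mu | f c.1 c.2 = k} = nu.rowLen k := by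
  have hanti : Antitone fun k => #{c ∈ skewCells lam mu | f c.1 c.2 = k} := by
    refine antitone_nat_of_succ_le fun k => ?_
    rw [← filter_skewCells_row_lt lam mu (fun c => f c.1 c.2 = k) le_rfl,
      ← filter_skewCells_row_lt lam mu (fun c => f c.1 c.2 = k + 1) (Nat.le_succ _)]
    exact hf.lattice _ k
  obtain ⟨nu, h⟩ := exists_youngDiagram_rowLen hanti
    (N := (skewCells lam mu).sup (fun c => f c.1 c.2) + 1) (by
      simp only [card_eq_zero]
      rw [filter_eq_empty_iff]
      intro c hc
      have := le_sup (f := fun c : ℕ × ℕ => f c.1 c.2) hc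
      omega)
  exact ⟨nu, fun k => (h k).symm⟩

/-- If the sorted tableaux coincided, all `rowCount`s would agree, hence also the number of entries
`k` in each row, contrary to `hne`. -/
theorem not_multiplicityFree_of_columnFillings {lam mu : YoungDiagram} {f g : ℕ → ℕ → ℕ}
    (hf : IsColumnFilling lam mu f) (hg : IsColumnFilling lam mu g)
    (hfg : ∀ k, #{c ∈ skewCells lam mu | f c.1 c.2 = k} = #{c ∈ skewCells lam mu | g c.1 c.2 = k})
    {n k : ℕ} (hne : #{c ∈ skewCells lam mu | c.1 < n ∧ f c.1 c.2 = k} ≠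
      #{c ∈ skewCells lam mu | c.1 < n ∧ g c.1 c.2 = k}) :
    ¬ SkewCharMultiplicityFree lam mu := by
  obtain ⟨nu, hnu⟩ := hf.exists_content
  obtain ⟨S, hS⟩ := hf.exists_lrTableau hnu
  obtain ⟨T, hT⟩ := hg.exists_lrTableau (nu := nu) (fun k => by rw [← hfg, hnu])
  have hST : S ≠ T := by
    rintro rfl
    have key : ∀ i k, rowCount lam mu f i k = rowCount lam mu g i k := by
      intro i k
      have h1 := rowCount_le lam mu f i k
      have h2 := rowCount_le lam mu g i k
      by_contra h
      rcases Nat.lt_or_gt_of_ne h with h | h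
      · have hc : (i, mu.rowLen i + rowCount lam mu f i k) ∈ skewCells lam mu :=
          mem_skewCells_row.2 (by omega)
        have := (hS _ _ hc k).symm.trans (hT _ _ hc k)
        omega
      · have hc : (i, mu.rowLen i + rowCount lam mu g i k) ∈ skewCells lam mu :=
          mem_skewCells_row.2 (by omega)
        have := (hS _ _ hc k).symm.trans (hT _ _ hc k)
        omega
    refine hne ?_
    rw [card_filter_skewCells_rows lam mu (fun i j => f i j = k),
      card_filter_skewCells_rows lam mu (fun i j => g i j = k)]
    refine sum_congr rfl fun i _ => ?_
    have h1 := rowCount_succ lam mu f i k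
    have h2 := rowCount_succ lam mu g i k
    have h3 := key i k
    have h4 := key i (k + 1)
    omega
  intro h
  have : Nontrivial (LRTableau lam mu nu) := ⟨S, T, hST⟩
  have h1 := Finite.one_lt_card (α := LRTableau lam mu nu)
  have := h nu
  unfold lrCoeff at this
  omega

/-! ### Columns made of segments of consecutive entries. -/

/-- The number of rows `i < n` of a column with rows `t ≤ i < b` in which the entry `g i` is `k`. -/
def colCount (t b : ℕ) (g : ℕ → ℕ) (n k : ℕ) : ℕ := #{i ∈ Ico t b | i < n ∧ g i = k}

theorem colCount_add {t u b : ℕ} (htu : t ≤ u) (hub : u ≤ b) (g : ℕ → ℕ) (n k : ℕ) :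
    colCount t b g n k = colCount t u g n k + colCount u b g n k := by
  unfold colCount
  rw [← card_union_of_disjoint, ← filter_union, Ico_union_Ico_eq_Ico htu hub]
  exact disjoint_filter_filter (Ico_disjoint_Ico_consecutive t u b)

/-- The count for a column segment that starts in row `r` and has entries `lo, …, hi - 1`. -/
def segCount (r lo hi n k : ℕ) : ℕ := if lo ≤ k ∧ k < hi ∧ r + k < n + lo then 1 else 0

theorem colCount_eq_segCount {r l lo : ℕ} {g : ℕ → ℕ}
    (hg : ∀ i, r ≤ i → i < r + l → g i = lo + (i - r)) (n k : ℕ) :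
    colCount r (r + l) g n k = segCount r lo (lo + l) n k := by
  unfold colCount segCount
  split_ifs with h
  · rw [card_eq_one]
    refine ⟨r + (k - lo), ?_⟩
    ext i
    simp only [mem_filter, mem_Ico, mem_singleton]
    constructor
    · rintro ⟨h1, h2, h3⟩
      rw [hg i h1.1 h1.2] at h3
      omega
    · rintro rfl
      rw [hg _ (by omega) (by omega)]
      omega
  · rw [card_eq_zero, filter_eq_empty_iff]
    rintro i hi ⟨h2, h3⟩
    rw [mem_Ico] at hi
    rw [hg i hi.1 hi.2] at h3
    omega

theorem exists_column_three_segments (t l₁ l₂ l₃ p q r b : ℕ) (hpq : p + l₁ ≤ q)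
    (hqr : q + l₂ ≤ r) (hb : b = t + l₁ + l₂ + l₃) :
    ∃ g : ℕ → ℕ, (∀ i, t ≤ i → i + 1 < b → g i < g (i + 1)) ∧
      ∀ n k, colCount t b g n k = segCount t p (p + l₁) n k +
        segCount (t + l₁) q (q + l₂) n k + segCount (t + l₁ + l₂) r (r + l₃) n k := by
  subst hb
  refine ⟨fun i => if i < t + l₁ then p + (i - t) else if i < t + l₁ + l₂ then q + (i - (t + l₁))
    else r + (i - (t + l₁ + l₂)), ?_, fun n k => ?_⟩
  · intro i h1 h2
    dsimp only
    split_ifs <;> omega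
  · rw [colCount_add (u := t + l₁ + l₂) (by omega) (by omega),
      colCount_add (u := t + l₁) (by omega) (by omega)]
    congr 1
    · congr 1
      · refine colCount_eq_segCount (fun i h1 h2 => ?_) n k
        rw [if_pos h2]
      · refine colCount_eq_segCount (fun i h1 h2 => ?_) n k
        rw [if_neg (by omega), if_pos h2]
    · refine colCount_eq_segCount (fun i h1 h2 => ?_) n k
      rw [if_neg (by omega), if_neg (by omega)]

theorem segCount_empty (r lo n k : ℕ) : segCount r lo lo n k = 0 := by
  unfold segCount
  rw [if_neg]
  omega

theorem exists_column_two_segments (t l₁ l₂ p q b : ℕ) (hpq : p + l₁ ≤ q) (hb : b = t + l₁ + l₂) :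
    ∃ g : ℕ → ℕ, (∀ i, t ≤ i → i + 1 < b → g i < g (i + 1)) ∧
      ∀ n k, colCount t b g n k = segCount t p (p + l₁) n k +
        segCount (t + l₁) q (q + l₂) n k := by
  obtain ⟨g, h1, h2⟩ := exists_column_three_segments t l₁ l₂ 0 p q (q + l₂) b hpq le_rfl hb
  refine ⟨g, h1, fun n k => ?_⟩
  rw [h2, Nat.add_zero, segCount_empty, Nat.add_zero]

theorem exists_column_one_segment (t l p b : ℕ) (hb : b = t + l) :
    ∃ g : ℕ → ℕ, (∀ i, t ≤ i → i + 1 < b → g i < g (i + 1)) ∧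
      ∀ n k, colCount t b g n k = segCount t p (p + l) n k := by
  obtain ⟨g, h1, h2⟩ := exists_column_two_segments t l 0 p (p + l) b le_rfl hb
  refine ⟨g, h1, fun n k => ?_⟩
  rw [h2, Nat.add_zero, segCount_empty, Nat.add_zero]

/-- Moving one row down and one entry up follows a segment along itself, so only its ends
contribute: a surplus at the last entry, a deficit at the first. The lattice condition thus reduces
to supplying each start `lo > 0` from a segment ending with `lo - 1` in an earlier row. -/
theorem segCount_succ_add (r lo hi n k : ℕ) (h : lo ≤ hi) :
    segCount r lo hi (n + 1) (k + 1) + (if k + 1 = hi ∧ r + k < n + lo then 1 else 0) =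
      segCount r lo hi n k + (if k + 1 = lo ∧ r ≤ n then 1 else 0) := by
  unfold segCount
  split_ifs <;> omega

/-! ### Two fillings of three columns. -/

/-- Fillings `g₁, g₂, g₃` of three columns, satisfying together the lattice condition for whole
rows. -/
structure IsTripleFilling (t₁ b₁ t₂ b₂ t₃ b₃ : ℕ) (g₁ g₂ g₃ : ℕ → ℕ) : Prop where
  strict₁ : ∀ i, t₁ ≤ i → i + 1 < b₁ → g₁ i < g₁ (i + 1)
  strict₂ : ∀ i, t₂ ≤ i → i + 1 < b₂ → g₂ i < g₂ (i + 1)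
  strict₃ : ∀ i, t₃ ≤ i → i + 1 < b₃ → g₃ i < g₃ (i + 1)
  lattice : ∀ n k, colCount t₁ b₁ g₁ (n + 1) (k + 1) + colCount t₂ b₂ g₂ (n + 1) (k + 1) +
      colCount t₃ b₃ g₃ (n + 1) (k + 1) ≤
    colCount t₁ b₁ g₁ n k + colCount t₂ b₂ g₂ n k + colCount t₃ b₃ g₃ n k

/-- Three columns have two fillings with the same content and different contents of some initial
segment of rows. -/
def HasTwoTripleFillings (t₁ b₁ t₂ b₂ t₃ b₃ : ℕ) : Prop :=
  ∃ g₁ g₂ g₃ h₁ h₂ h₃ : ℕ → ℕ, IsTripleFilling t₁ b₁ t₂ b₂ t₃ b₃ g₁ g₂ g₃ ∧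
    IsTripleFilling t₁ b₁ t₂ b₂ t₃ b₃ h₁ h₂ h₃ ∧
    (∀ n k, b₁ ≤ n → b₂ ≤ n → b₃ ≤ n →
      colCount t₁ b₁ g₁ n k + colCount t₂ b₂ g₂ n k + colCount t₃ b₃ g₃ n k =
        colCount t₁ b₁ h₁ n k + colCount t₂ b₂ h₂ n k + colCount t₃ b₃ h₃ n k) ∧
    ∃ n k, colCount t₁ b₁ g₁ n k + colCount t₂ b₂ g₂ n k + colCount t₃ b₃ g₃ n k ≠
        colCount t₁ b₁ h₁ n k + colCount t₂ b₂ h₂ n k + colCount t₃ b₃ h₃ n k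

theorem hasTwoTripleFillings_of_last {t₁ b₁ t₂ b₂ t₃ b₃ : ℕ} (h₁ : t₁ < b₁) (h₂ : t₂ < b₂)
    (h₃ : t₃ < b₃) (ht : t₁ < t₂) (hb : b₁ < b₂) (h₂₃ : b₂ ≤ t₃) :
    HasTwoTripleFillings t₁ b₁ t₂ b₂ t₃ b₃ := by
  obtain ⟨x, rfl⟩ := Nat.exists_eq_add_of_lt h₁
  obtain ⟨y, rfl⟩ := Nat.exists_eq_add_of_lt h₂
  obtain ⟨z, rfl⟩ := Nat.exists_eq_add_of_lt h₃
  -- `m` and `w` are the last entries of the shorter and the longer of the first two canonical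
  -- columns.
  obtain ⟨m, hm⟩ : ∃ m, m = min x y := ⟨_, rfl⟩
  obtain ⟨w, hw⟩ : ∃ w, w = max x y := ⟨_, rfl⟩
  obtain ⟨g₁, hg₁, cg₁⟩ := exists_column_one_segment t₁ (x + 1) 0 _ rfl
  obtain ⟨g₂, hg₂, cg₂⟩ := exists_column_one_segment t₂ (y + 1) 0 _ rfl
  obtain ⟨g₃, hg₃, cg₃⟩ := exists_column_one_segment t₃ (z + 1) (w + 1) _ rfl
  -- The second filling exchanges `m` in column 2 for `w + 1` from column 3. The entry `x + 1` in
  -- row `t₂ + m` is preceded by the final `x` of column 1: by `ht` if `x ≤ y`, by `hb` if `y ≤ x`.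
  -- The number of `m` differs once row `t₂ + m` is included.
  obtain ⟨k₂, hk₂, ck₂⟩ := exists_column_two_segments t₂ m (y + 1 - m) 0 (x + 1) (t₂ + y + 1)
    (by omega) (by omega)
  obtain ⟨k₃, hk₃, ck₃⟩ := exists_column_two_segments t₃ 1 z m (w + 2) (t₃ + z + 1)
    (by omega) (by omega)
  refine ⟨g₁, g₂, g₃, g₁, k₂, k₃, ⟨hg₁, hg₂, hg₃, fun n k => ?_⟩, ⟨hg₁, hk₂, hk₃, fun n k => ?_⟩,
    fun n k hn₁ hn₂ hn₃ => ?_, t₂ + m + 1, m, ?_⟩ <;>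
    simp only [← Nat.add_assoc] at cg₁ cg₂ cg₃ ck₂ ck₃ <;>
    simp only [cg₁, cg₂, cg₃, ck₂, ck₃] <;>
    clear hg₁ hg₂ hg₃ hk₂ hk₃ cg₁ cg₂ cg₃ ck₂ ck₃ g₁ g₂ g₃ k₂ k₃
  · have e₁ := segCount_succ_add t₁ 0 (0 + x + 1) n k (by omega)
    have e₂ := segCount_succ_add t₂ 0 (0 + y + 1) n k (by omega)
    have e₃ := segCount_succ_add t₃ (w + 1) (w + 1 + z + 1) n k (by omega)
    rcases le_total x y with h | h
    · obtain rfl : m = x := by omega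
      obtain rfl : w = y := by omega
      clear hm hw
      grind (splits := 40)
    · obtain rfl : m = y := by omega
      obtain rfl : w = x := by omega
      clear hm hw
      grind (splits := 40)
  · have e₁ := segCount_succ_add t₁ 0 (0 + x + 1) n k (by omega)
    have e₂ := segCount_succ_add t₂ 0 (0 + m) n k (by omega)
    have e₃ := segCount_succ_add (t₂ + m) (x + 1) (x + 1 + (y + 1 - m)) n k (by omega)
    have e₄ := segCount_succ_add t₃ m (m + 1) n k (by omega)
    have e₅ := segCount_succ_add (t₃ + 1) (w + 2) (w + 2 + z) n k (by omega)
    rcases le_total x y with h | h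
    · obtain rfl : m = x := by omega
      obtain rfl : w = y := by omega
      clear hm hw
      grind (splits := 40)
    · obtain rfl : m = y := by omega
      obtain rfl : w = x := by omega
      clear hm hw
      grind (splits := 40)
  · unfold segCount
    rcases le_total x y with h | h
    · obtain rfl : m = x := by omega
      obtain rfl : w = y := by omega
      clear hm hw
      grind (splits := 40)
    · obtain rfl : m = y := by omega
      obtain rfl : w = x := by omega
      clear hm hw
      grind (splits := 40)
  · unfold segCount
    rcases le_total x y with h | h
    · obtain rfl : m = x := by omega
      obtain rfl : w = y := by omega
      clear hm hw
      grind (splits := 40)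
    · obtain rfl : m = y := by omega
      obtain rfl : w = x := by omega
      clear hm hw
      grind (splits := 40)

theorem hasTwoTripleFillings_of_first {t₁ b₁ t₂ b₂ t₃ b₃ : ℕ} (h₁ : t₁ < b₁) (h₂ : t₂ < b₂)
    (h₃ : t₃ < b₃) (h₁₂ : b₁ ≤ t₂) (ht : t₂ < t₃) (hb : b₂ < b₃) :
    HasTwoTripleFillings t₁ b₁ t₂ b₂ t₃ b₃ := by
  -- `c + 1` is the least of the three column lengths; `z`, `x`, `y` are the excesses of columns 1,
  -- 2, 3.
  obtain ⟨c, z, x, y, hc, rfl, rfl, rfl⟩ : ∃ c z x y, (x = 0 ∨ y = 0 ∨ z = 0) ∧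
      b₁ = t₁ + (c + 1 + z) ∧ b₂ = t₂ + (c + 1 + x) ∧ b₃ = t₃ + (c + 1 + y) := by
    refine ⟨min (min (b₂ - t₂) (b₃ - t₃)) (b₁ - t₁) - 1,
      b₁ - t₁ - min (min (b₂ - t₂) (b₃ - t₃)) (b₁ - t₁),
      b₂ - t₂ - min (min (b₂ - t₂) (b₃ - t₃)) (b₁ - t₁),
      b₃ - t₃ - min (min (b₂ - t₂) (b₃ - t₃)) (b₁ - t₁), ?_⟩
    omega
  -- The fillings will differ by exchanging `c` in column 2 with `z + x + c + 1` in column 3. If `y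
  -- ≤ z + x`, the latter is the last entry of column 3 and its exchange leaves the canonical column
  -- (`u = 0`); otherwise it lies inside the run `c + 1, …, c + 1 + y`, and removing it leaves a gap
  -- after `v` entries.
  obtain ⟨v, u, w, hvw, hvu⟩ : ∃ v u w, (u = 0 ∧ y ≤ z + x ∧ w = z + x + c + 1 ∨
      v = z + x + c + 1 ∧ z + x ≤ y ∧ w = c + 1 + y) ∧ v + u = c + 1 + y := by
    rcases le_total y (z + x) with h | h
    · exact ⟨c + 1 + y, 0, _, Or.inl ⟨rfl, h, rfl⟩, rfl⟩
    · exact ⟨z + x + c + 1, y - (z + x), _, Or.inr ⟨rfl, h, rfl⟩, by omega⟩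
  obtain ⟨g₁, hg₁, cg₁⟩ := exists_column_one_segment t₁ (c + 1 + z) 0 _ rfl
  obtain ⟨g₂, hg₂, cg₂⟩ := exists_column_two_segments t₂ (c + 1) x 0 (c + 1 + z)
    (t₂ + (c + 1 + x)) (by omega) (by omega)
  obtain ⟨g₃, hg₃, cg₃⟩ := exists_column_three_segments t₃ c y 1 0 (c + 1) w
    (t₃ + (c + 1 + y)) (by omega) (by omega) (by omega)
  obtain ⟨k₂, hk₂, ck₂⟩ := exists_column_two_segments t₂ c (x + 1) 0 (c + 1 + z)
    (t₂ + (c + 1 + x)) (by omega) (by omega)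
  obtain ⟨k₃, hk₃, ck₃⟩ := exists_column_two_segments t₃ v u 0 (z + x + c + 2)
    (t₃ + (c + 1 + y)) (by omega) (by omega)
  -- The first `t₂ + c + 1` rows separate the fillings: column 2 has `c` in row `t₂ + c` in the
  -- first one, while in the second it sits in row `t₃ + c` of column 3, which is lower.
  refine ⟨g₁, g₂, g₃, g₁, k₂, k₃, ⟨hg₁, hg₂, hg₃, fun n k => ?_⟩, ⟨hg₁, hk₂, hk₃, fun n k => ?_⟩,
    fun n k hn₁ hn₂ hn₃ => ?_, t₂ + c + 1, c, ?_⟩ <;>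
    simp only [cg₁, cg₂, cg₃, ck₂, ck₃] <;>
    clear hg₁ hg₂ hg₃ hk₂ hk₃ cg₁ cg₂ cg₃ ck₂ ck₃ g₁ g₂ g₃ k₂ k₃
  · have e₁ := segCount_succ_add t₁ 0 (0 + (c + 1 + z)) n k (by omega)
    have e₂ := segCount_succ_add t₂ 0 (0 + (c + 1)) n k (by omega)
    have e₃ := segCount_succ_add (t₂ + (c + 1)) (c + 1 + z) (c + 1 + z + x) n k (by omega)
    have e₄ := segCount_succ_add t₃ 0 (0 + c) n k (by omega)
    have e₅ := segCount_succ_add (t₃ + c) (c + 1) (c + 1 + y) n k (by omega)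
    have e₆ := segCount_succ_add (t₃ + c + y) w (w + 1) n k (by omega)
    rcases hvw with ⟨rfl, h, rfl⟩ | ⟨rfl, h, rfl⟩ <;> rcases hc with rfl | rfl | rfl <;>
      grind (splits := 40)
  · have e₁ := segCount_succ_add t₁ 0 (0 + (c + 1 + z)) n k (by omega)
    have e₂ := segCount_succ_add t₂ 0 (0 + c) n k (by omega)
    have e₃ := segCount_succ_add (t₂ + c) (c + 1 + z) (c + 1 + z + (x + 1)) n k (by omega)
    have e₄ := segCount_succ_add t₃ 0 (0 + v) n k (by omega)
    have e₅ := segCount_succ_add (t₃ + v) (z + x + c + 2) (z + x + c + 2 + u) n k (by omega)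
    rcases hvw with ⟨rfl, h, rfl⟩ | ⟨rfl, h, rfl⟩ <;> rcases hc with rfl | rfl | rfl <;>
      grind (splits := 40)
  · unfold segCount
    rcases hvw with ⟨rfl, h, rfl⟩ | ⟨rfl, h, rfl⟩ <;> rcases hc with rfl | rfl | rfl <;>
      grind (splits := 40)
  · unfold segCount
    rcases hvw with ⟨rfl, h, rfl⟩ | ⟨rfl, h, rfl⟩ <;> rcases hc with rfl | rfl | rfl <;>
      grind (splits := 40)

/-! ### From three columns to the whole skew diagram. -/

/-- Replace the entries in the columns `j₁, j₂, j₃` of the canonical filling, in which the entry of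
a box is its distance to the top of its column. -/
def tripleFilling (mu : YoungDiagram) (j₁ j₂ j₃ : ℕ) (g₁ g₂ g₃ : ℕ → ℕ) (i j : ℕ) : ℕ :=
  if j = j₁ then g₁ i else if j = j₂ then g₂ i else if j = j₃ then g₃ i else i - mu.colLen j

section

variable {lam mu : YoungDiagram} {j₁ j₂ j₃ : ℕ} {g₁ g₂ g₃ : ℕ → ℕ}

theorem lt_rowLen_zero {j : ℕ} (h : mu.colLen j < lam.colLen j) : j < lam.rowLen 0 := by
  rw [← YoungDiagram.mem_iff_lt_rowLen, YoungDiagram.mem_iff_lt_colLen]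
  omega

theorem card_tripleFilling (h₁ : mu.colLen j₁ < lam.colLen j₁) (h₂ : mu.colLen j₂ < lam.colLen j₂)
    (h₃ : mu.colLen j₃ < lam.colLen j₃) (h₁₂ : j₁ ≠ j₂) (h₁₃ : j₁ ≠ j₃) (h₂₃ : j₂ ≠ j₃) (n k : ℕ) :
    #{c ∈ skewCells lam mu | c.1 < n ∧ tripleFilling mu j₁ j₂ j₃ g₁ g₂ g₃ c.1 c.2 = k} =
      (∑ j ∈ range (lam.rowLen 0) \ {j₁, j₂, j₃},
        colCount (mu.colLen j) (lam.colLen j) (fun i => i - mu.colLen j) n k) +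
      (colCount (mu.colLen j₁) (lam.colLen j₁) g₁ n k +
        colCount (mu.colLen j₂) (lam.colLen j₂) g₂ n k +
        colCount (mu.colLen j₃) (lam.colLen j₃) g₃ n k) := by
  rw [card_filter_skewCells_cols lam mu
    (fun i j => i < n ∧ tripleFilling mu j₁ j₂ j₃ g₁ g₂ g₃ i j = k)]
  have hsub : ({j₁, j₂, j₃} : Finset ℕ) ⊆ range (lam.rowLen 0) := by
    intro j hj
    simp only [mem_insert, mem_singleton] at hj
    rw [mem_range]
    rcases hj with rfl | rfl | rfl <;> exact lt_rowLen_zero ‹_›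
  rw [← sum_sdiff hsub]
  congr 1
  · refine sum_congr rfl fun j hj => ?_
    simp only [mem_sdiff, mem_insert, mem_singleton, not_or] at hj
    simp only [tripleFilling, if_neg hj.2.1, if_neg hj.2.2.1, if_neg hj.2.2.2, colCount]
  · rw [sum_insert (by simp [h₁₂, h₁₃]), sum_insert (by simp [h₂₃]), sum_singleton, ← add_assoc]
    simp [tripleFilling, colCount, h₁₂.symm, h₁₃.symm, h₂₃.symm]

theorem colCount_canonical (t b n k : ℕ) :
    colCount t b (fun i => i - t) (n + 1) (k + 1) ≤ colCount t b (fun i => i - t) n k := by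
  rcases le_total t b with h | h
  · obtain ⟨l, rfl⟩ := Nat.exists_eq_add_of_le h
    rw [colCount_eq_segCount (lo := 0) (fun i _ _ => (Nat.zero_add _).symm),
      colCount_eq_segCount (lo := 0) (fun i _ _ => (Nat.zero_add _).symm)]
    unfold segCount
    split_ifs <;> omega
  · simp [colCount, Ico_eq_empty_of_le h]

theorem IsTripleFilling.isColumnFilling
    (hg : IsTripleFilling (mu.colLen j₁) (lam.colLen j₁) (mu.colLen j₂) (lam.colLen j₂)
      (mu.colLen j₃) (lam.colLen j₃) g₁ g₂ g₃)
    (h₁ : mu.colLen j₁ < lam.colLen j₁) (h₂ : mu.colLen j₂ < lam.colLen j₂)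
    (h₃ : mu.colLen j₃ < lam.colLen j₃) (h₁₂ : j₁ ≠ j₂) (h₁₃ : j₁ ≠ j₃) (h₂₃ : j₂ ≠ j₃) :
    IsColumnFilling lam mu (tripleFilling mu j₁ j₂ j₃ g₁ g₂ g₃) := by
  refine ⟨fun i j hi hi' => ?_, fun n k => ?_⟩
  · rw [mem_skewCells_col] at hi hi'
    unfold tripleFilling
    split_ifs with e₁ e₂ e₃
    · subst e₁
      exact hg.strict₁ i hi.1 hi'.2
    · subst e₂
      exact hg.strict₂ i hi.1 hi'.2
    · subst e₃
      exact hg.strict₃ i hi.1 hi'.2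
    · omega
  · rw [card_tripleFilling h₁ h₂ h₃ h₁₂ h₁₃ h₂₃, card_tripleFilling h₁ h₂ h₃ h₁₂ h₁₃ h₂₃]
    exact add_le_add (sum_le_sum fun j _ => colCount_canonical _ _ n k) (hg.lattice n k)

theorem HasTwoTripleFillings.not_multiplicityFree
    (h : HasTwoTripleFillings (mu.colLen j₁) (lam.colLen j₁) (mu.colLen j₂) (lam.colLen j₂)
      (mu.colLen j₃) (lam.colLen j₃))
    (h₁ : mu.colLen j₁ < lam.colLen j₁) (h₂ : mu.colLen j₂ < lam.colLen j₂)
    (h₃ : mu.colLen j₃ < lam.colLen j₃) (h₁₂ : j₁ ≠ j₂) (h₁₃ : j₁ ≠ j₃) (h₂₃ : j₂ ≠ j₃) :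
    ¬ SkewCharMultiplicityFree lam mu := by
  obtain ⟨f₁, f₂, f₃, g₁, g₂, g₃, hf, hg, heq, n, k, hne⟩ := h
  refine not_multiplicityFree_of_columnFillings
    (hf.isColumnFilling h₁ h₂ h₃ h₁₂ h₁₃ h₂₃) (hg.isColumnFilling h₁ h₂ h₃ h₁₂ h₁₃ h₂₃)
    (fun k => ?_) (n := n) (k := k) ?_
  · rw [← filter_skewCells_row_lt lam mu
        (fun c => tripleFilling mu j₁ j₂ j₃ f₁ f₂ f₃ c.1 c.2 = k) le_rfl,
      ← filter_skewCells_row_lt lam mu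
        (fun c => tripleFilling mu j₁ j₂ j₃ g₁ g₂ g₃ c.1 c.2 = k) le_rfl,
      card_tripleFilling h₁ h₂ h₃ h₁₂ h₁₃ h₂₃, card_tripleFilling h₁ h₂ h₃ h₁₂ h₁₃ h₂₃]
    rw [heq _ k] <;> exact lam.colLen_anti 0 _ (Nat.zero_le _)
  · rw [card_tripleFilling h₁ h₂ h₃ h₁₂ h₁₃ h₂₃, card_tripleFilling h₁ h₂ h₃ h₁₂ h₁₃ h₂₃]
    omega

end

/-! ### Geometry of disconnected parts and conclusion. -/

namespace DecomposesInto

variable {lam mu : YoungDiagram} {A B : Finset (ℕ × ℕ)}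

theorem symm {D : Finset (ℕ × ℕ)} (h : DecomposesInto D A B) : DecomposesInto D B A where
  union_eq := by rw [union_comm, h.union_eq]
  left_nonempty := h.right_nonempty
  right_nonempty := h.left_nonempty
  disconnected a ha b hb := ⟨(h.disconnected b hb a ha).1.symm, (h.disconnected b hb a ha).2.symm⟩

theorem mem_of_mem_left {D : Finset (ℕ × ℕ)} (h : DecomposesInto D A B) {c : ℕ × ℕ} (hc : c ∈ A) :
    c ∈ D := by
  rw [← h.union_eq]
  exact mem_union_left _ hc

theorem mem_left_of_mem {D : Finset (ℕ × ℕ)} (h : DecomposesInto D A B) {c d : ℕ × ℕ} (hc : c ∈ A)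
    (hd : d ∈ D) (hcd : c.1 = d.1 ∨ c.2 = d.2) : d ∈ A := by
  rw [← h.union_eq, mem_union] at hd
  refine hd.resolve_right fun hB => ?_
  have := h.disconnected c hc d hB
  tauto

/-- A column that meets `A` is contained in `A`. -/
theorem mem_left_iff (h : DecomposesInto (skewCells lam mu) A B) {i j : ℕ} (hij : (i, j) ∈ A)
    (i' : ℕ) : (i', j) ∈ A ↔ mu.colLen j ≤ i' ∧ i' < lam.colLen j := by
  rw [← mem_skewCells_col]
  exact ⟨h.mem_of_mem_left, fun h' => h.mem_left_of_mem hij h' (Or.inr rfl)⟩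

/-- Columns are intervals of rows; if two overlapped, the larger of their top rows would meet both
parts. -/
theorem rows_disjoint (h : DecomposesInto (skewCells lam mu) A B) {i j i' j' : ℕ}
    (hA : (i, j) ∈ A) (hB : (i', j') ∈ B) :
    lam.colLen j ≤ mu.colLen j' ∨ lam.colLen j' ≤ mu.colLen j := by
  by_contra hcon
  have h1 := (h.mem_left_iff hA i).1 hA
  have h2 := (h.symm.mem_left_iff hB i').1 hB
  have h3 := (h.mem_left_iff hA (max (mu.colLen j) (mu.colLen j'))).2 (by omega)
  have h4 := (h.symm.mem_left_iff hB (max (mu.colLen j) (mu.colLen j'))).2 (by omega)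
  exact (h.disconnected _ h3 _ h4).1 rfl

/-- Column tops are monotone, so equal tops at the two extreme columns force all tops of `A` to be
`t`. Row `t` then links every column in between to `A`, leaving no gaps. -/
theorem isPartitionShape (h : DecomposesInto (skewCells lam mu) A B) {p q : ℕ × ℕ} (hp : p ∈ A)
    (hq : q ∈ A) (hpq : ∀ c ∈ A, q.2 ≤ c.2 ∧ c.2 ≤ p.2) (heq : mu.colLen p.2 = mu.colLen q.2) :
    IsPartitionShape A := by
  obtain ⟨t, ht⟩ : ∃ t, t = mu.colLen p.2 := ⟨_, rfl⟩
  obtain ⟨ip, jp⟩ := p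
  obtain ⟨iq, jq⟩ := q
  dsimp only at *
  have hp' := (h.mem_left_iff hp ip).1 hp
  have key : ∀ i j, (i, j) ∈ A ↔ (jq ≤ j ∧ j ≤ jp) ∧ t ≤ i ∧ i < lam.colLen j := by
    intro i j
    constructor
    · intro hij
      have h1 := hpq _ hij
      dsimp only at h1
      have h2 := mu.colLen_anti _ _ h1.1
      have h3 := mu.colLen_anti _ _ h1.2
      have h4 := (h.mem_left_iff hij i).1 hij
      omega
    · rintro ⟨h1, h2⟩
      have h3 := mu.colLen_anti _ _ h1.1
      have h4 := mu.colLen_anti _ _ h1.2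
      have h5 := lam.colLen_anti _ _ h1.2
      have h6 : (t, jp) ∈ A := (h.mem_left_iff hp t).2 (by omega)
      have h7 : (t, j) ∈ A := h.mem_left_of_mem h6 (mem_skewCells_col.2 (by omega)) (Or.inl rfl)
      exact (h.mem_left_iff h7 i).2 (by omega)
  have hmem : ∀ i j, (i, j) ∈ A.image (fun c => (c.1 - t, c.2 - jq)) ↔ (t + i, jq + j) ∈ A := by
    intro i j
    simp only [mem_image, Prod.exists, Prod.mk.injEq]
    constructor
    · rintro ⟨a, b, hab, rfl, rfl⟩
      have := (key a b).1 hab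
      rwa [Nat.add_sub_cancel' (by omega), Nat.add_sub_cancel' (by omega)]
    · exact fun hij => ⟨_, _, hij, by omega, by omega⟩
  refine ⟨⟨A.image (fun c => (c.1 - t, c.2 - jq)), ?_⟩, t, jq, fun i j => ?_⟩
  · rintro ⟨i, j⟩ ⟨i', j'⟩ ⟨hi, hj⟩ hij
    rw [mem_coe, hmem, key] at hij ⊢
    dsimp only at hi hj
    have := lam.colLen_anti (jq + j') (jq + j) (by omega)
    omega
  · rw [← YoungDiagram.mem_cells, hmem]
    constructor
    · intro hij
      have := (key i j).1 hij
      refine ⟨by omega, by omega, ?_⟩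
      rwa [Nat.add_sub_cancel' (by omega), Nat.add_sub_cancel' (by omega)]
    · rintro ⟨h1, h2, h3⟩
      rwa [Nat.add_sub_cancel' h1, Nat.add_sub_cancel' h2] at h3

/-- The mirror argument: all columns of `A` end in the common bottom row `s`, which links them. -/
theorem isRotatedPartitionShape (h : DecomposesInto (skewCells lam mu) A B) {p q : ℕ × ℕ}
    (hp : p ∈ A) (hq : q ∈ A) (hpq : ∀ c ∈ A, q.2 ≤ c.2 ∧ c.2 ≤ p.2)
    (heq : lam.colLen p.2 = lam.colLen q.2) : IsRotatedPartitionShape A := by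
  obtain ⟨ip, jp⟩ := p
  obtain ⟨iq, jq⟩ := q
  dsimp only at *
  have hp' := (h.mem_left_iff hp ip).1 hp
  have hq' := (h.mem_left_iff hq iq).1 hq
  obtain ⟨s, hs⟩ : ∃ s, s + 1 = lam.colLen jp := ⟨lam.colLen jp - 1, by omega⟩
  have key : ∀ i j, (i, j) ∈ A ↔ (jq ≤ j ∧ j ≤ jp) ∧ mu.colLen j ≤ i ∧ i ≤ s := by
    intro i j
    constructor
    · intro hij
      have h1 := hpq _ hij
      dsimp only at h1
      have h2 := lam.colLen_anti _ _ h1.1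
      have h3 := lam.colLen_anti _ _ h1.2
      have h4 := (h.mem_left_iff hij i).1 hij
      omega
    · rintro ⟨h1, h2⟩
      have h3 := lam.colLen_anti _ _ h1.1
      have h4 := lam.colLen_anti _ _ h1.2
      have h5 := mu.colLen_anti _ _ h1.1
      have h6 : (s, jq) ∈ A := (h.mem_left_iff hq s).2 (by omega)
      have h7 : (s, j) ∈ A := h.mem_left_of_mem h6 (mem_skewCells_col.2 (by omega)) (Or.inl rfl)
      exact (h.mem_left_iff h7 i).2 (by omega)
  have hmem : ∀ i j, (i, j) ∈ A.image (fun c => (s - c.1, jp - c.2)) ↔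
      i ≤ s ∧ j ≤ jp ∧ (s - i, jp - j) ∈ A := by
    intro i j
    simp only [mem_image, Prod.exists, Prod.mk.injEq]
    constructor
    · rintro ⟨a, b, hab, rfl, rfl⟩
      have := (key a b).1 hab
      refine ⟨by omega, by omega, ?_⟩
      rwa [Nat.sub_sub_self (by omega), Nat.sub_sub_self (by omega)]
    · rintro ⟨h1, h2, hij⟩
      exact ⟨_, _, hij, by omega, by omega⟩
  refine ⟨⟨A.image (fun c => (s - c.1, jp - c.2)), ?_⟩, s, jp, fun i j => ?_⟩
  · rintro ⟨i, j⟩ ⟨i', j'⟩ ⟨hi, hj⟩ hij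
    rw [mem_coe, hmem, key] at hij ⊢
    dsimp only at hi hj
    have := mu.colLen_anti (jp - j) (jp - j') (by omega)
    omega
  · rw [← YoungDiagram.mem_cells, hmem]
    constructor
    · intro hij
      have := (key i j).1 hij
      refine ⟨by omega, by omega, by omega, by omega, ?_⟩
      rwa [Nat.sub_sub_self (by omega), Nat.sub_sub_self (by omega)]
    · rintro ⟨h1, h2, -, -, h3⟩
      rwa [Nat.sub_sub_self h1, Nat.sub_sub_self h2] at h3

/-- The rightmost and the leftmost column of a proper part start in different rows and end in
different rows. -/
theorem exists_columns_of_isProper (h : DecomposesInto (skewCells lam mu) A B) (hA : IsProper A) :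
    ∃ p ∈ A, ∃ q ∈ A, mu.colLen p.2 < mu.colLen q.2 ∧ lam.colLen p.2 < lam.colLen q.2 := by
  obtain ⟨p, hp, hpmax⟩ := exists_max_image A Prod.snd h.left_nonempty
  obtain ⟨q, hq, hqmin⟩ := exists_min_image A Prod.snd h.left_nonempty
  have hpq : ∀ c ∈ A, q.2 ≤ c.2 ∧ c.2 ≤ p.2 := fun c hc => ⟨hqmin c hc, hpmax c hc⟩
  refine ⟨p, hp, q, hq, lt_of_le_of_ne (mu.colLen_anti _ _ (hqmin p hp)) fun heq => ?_,
    lt_of_le_of_ne (lam.colLen_anti _ _ (hqmin p hp)) fun heq => ?_⟩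
  · exact hA.1 (h.isPartitionShape hp hq hpq heq)
  · exact hA.2 (h.isRotatedPartitionShape hp hq hpq heq)

theorem not_multiplicityFree_of_isProper_left (h : DecomposesInto (skewCells lam mu) A B)
    (hA : IsProper A) : ¬ SkewCharMultiplicityFree lam mu := by
  obtain ⟨⟨ip, jp⟩, hp, ⟨iq, jq⟩, hq, hmu, hlam⟩ := h.exists_columns_of_isProper hA
  obtain ⟨⟨ib, jb⟩, hb⟩ := h.right_nonempty
  dsimp only at hmu hlam
  have lp : mu.colLen jp < lam.colLen jp := by have := (h.mem_left_iff hp ip).1 hp; omega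
  have lq : mu.colLen jq < lam.colLen jq := by have := (h.mem_left_iff hq iq).1 hq; omega
  have lb : mu.colLen jb < lam.colLen jb := by have := (h.symm.mem_left_iff hb ib).1 hb; omega
  have npq : jp ≠ jq := by rintro rfl; omega
  have npb : jp ≠ jb := (h.disconnected _ hp _ hb).2
  have nqb : jq ≠ jb := (h.disconnected _ hq _ hb).2
  -- The column of `B` lies below both columns of `A`, between them, or above the rightmost one. In
  -- the middle case it plays the second column, with the leftmost column of `A` as the third.
  rcases h.rows_disjoint hp hb with h₁ | h₁
  · rcases h.rows_disjoint hq hb with h₂ | h₂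
    · exact (hasTwoTripleFillings_of_last lp lq lb hmu hlam h₂).not_multiplicityFree
        lp lq lb npq npb nqb
    · exact (hasTwoTripleFillings_of_first lp lb lq h₁ (by omega) (by omega)).not_multiplicityFree
        lp lb lq npb npq nqb.symm
  · exact (hasTwoTripleFillings_of_first lb lp lq h₁ hmu hlam).not_multiplicityFree
      lb lp lq npb.symm nqb.symm npq

end DecomposesInto

end SkewLR

theorem proposition3p7 (lam alpha : YoungDiagram) (hsub : alpha ≤ lam)
    (A B : Finset (ℕ × ℕ))
    (hdec : SkewLR.DecomposesInto (SkewLR.skewCells lam alpha) A B)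
    (hproper : SkewLR.IsProper A ∨ SkewLR.IsProper B) :
    ¬ SkewLR.SkewCharMultiplicityFree lam alpha := by
  exact hproper.elim hdec.not_multiplicityFree_of_isProper_left
    hdec.symm.not_multiplicityFree_of_isProper_left
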